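/- **Setting.** Let $n$ links and $c$ channels be given, and a conflict graph $G$ on $[n]$ (a simple graph). A feasible configuration is a matrix $M\in\{0,1\}^{n\times c}$ with $\sum_j M_{ij}\le 1$ for all $i$, and $M_{ij}M_{i'j}=0$ for all $j$ whenever $i,i'$ are adjacent in $G$; let $\mathcal M$ be the set of feasible configurations. Fix $m\ge 1$ and $\Theta=[0,1]^{n\times c}$. Under parameter $\theta\in\Theta$ the rewards $r_{ij}(t)$, $t\ge 1$, are independent over $i,j$ and i.i.d. over $t$, with $m\,r_{ij}(t)\sim \mathrm{Bin}(m,\theta_{ij})$ (Bernoulli rewards if $m=1$). A policy $\pi$ selects in every slot $t$ a configuration $M^\pi(t)\in\mathcal M$, possibly at random, with a distribution that depends on the previously selected configurations and on the detailed feedback $(r_{ij}(s) : M^\pi_{ij}(s)=1)$, $s<t$. Write $r_M(t)=\sum_{i,j}M_{ij}r_{ij}(t)$, $\mu^M(\theta)=\sum_{i,j}M_{ij}\theta_{ij}$, $\mu^\star=\max_{M\in\mathcal M}\mu^M(\theta)$, and define the regret $$R^\pi(T)=\max_{M\in\mathcal M}\mathbb E\Big[\sum_{t=1}^T r_M(t)\Big]-\mathbb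 E\Big[\sum_{t=1}^T r_{M^\pi(t)}(t)\Big].$$ The policy $\pi$ is uniformly good if for every $\theta\in\Theta$ that has a unique optimal configuration $M^\star$, every $M\ne M^\star$ and every $\gamma>0$, the number $T_M(t)$ of times that $M$ is selected up to slot $t$ satisfies $\mathbb E[T_M(t)]=o(t^\gamma)$. For $\theta$ with unique optimal configuration $M^\star$ and $M\neq M^\star$ let $$B_M(\theta)=\{\lambda\in\Theta : \lambda_{ij}=\theta_{ij}\text{ whenever }M^\star_{ij}=1,\text{ and }\mu^\star<\mu^M(\lambda)\},$$ and for $\lambda\in\Theta$ let $$KL^M(\theta,\lambda)=\sum_{i\in[n]}\ \sum_{y\in\{0,1/m,\dots,1\}}p_i(y;M,\theta)\log\frac{p_i(y;M,\theta)}{p_i(y;M,\lambda)}\in[0,\infty]$$ (with $0\log\frac0q=0$ and $p\log\frac p0=\infty$ for $p>0$), where $p_i(\cdot\,;M,\theta)$ is the law of $Y/m$ with $Y\sim\mathrm{Bin}(m,\theta_{ij})$ if $M_{ij}=1$, and the point mass at $0$ if $\sum_jM_{ij}=0$. **Theorem.** For every $\theta\in\Theta$ with a unique optimal configuration $M^\star$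 and every uniformly good policy $\pi$, $$\liminf_{T\to\infty}\frac{R^\pi(T)}{\log T}\ \ge\ C(\theta),$$ where $C(\theta)$ is the value of the optimisation problem $$\inf_{x_M\ge 0,\ M\in\mathcal M}\ \sum_{M\in\mathcal M}x_M\big(\mu^\star-\mu^M(\theta)\big)\quad\text{s.t.}\quad \inf_{\lambda\in B_M(\theta)}\ \sum_{Q\neq M^\star}x_Q\,KL^Q(\theta,\lambda)\ge 1\quad\text{for all } M\neq M^\star$$ (an infimum over the empty set is $+\infty$, and $0\cdot\infty=0$). -/

import Mathlib

open Filter Topology Asymptotics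
open scoped ENNReal NNReal

noncomputable section

namespace SpectrumBandit

/-- Parameters: `θ i j ∈ [0,1]` is the mean number of successfully transmitted packets per slot on
link `i` and channel `j`. -/
abbrev Param (n c : ℕ) := Fin n → Fin c → unitInterval

/-- Feasibility of a `0/1` matrix for the conflict graph `G`: every link uses at most one channel,
and interfering links are not active on the same channel. -/
def IsFeasible {n : ℕ} (G : SimpleGraph (Fin n)) {c : ℕ} (M : Fin n → Fin c → Bool) : Prop :=
  (∀ i j j', M i j = true → M i j' = true → j = j') ∧
    ∀ i i', G.Adj i i' → ∀ j, ¬ (M i j = true ∧ M i' j = true)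

/-- The finite set of feasible configurations. -/
def Config {n : ℕ} (G : SimpleGraph (Fin n)) (c : ℕ) :=
  {M : Fin n → Fin c → Bool // IsFeasible G M}

instance {n : ℕ} (G : SimpleGraph (Fin n)) (c : ℕ) : Finite (Config G c) :=
  inferInstanceAs (Finite {M : Fin n → Fin c → Bool // IsFeasible G M})

instance {n : ℕ} (G : SimpleGraph (Fin n)) (c : ℕ) : Fintype (Config G c) := Fintype.ofFinite _

instance {n : ℕ} (G : SimpleGraph (Fin n)) (c : ℕ) : DecidableEq (Config G c) :=
  inferInstanceAs (DecidableEq {M : Fin n → Fin c → Bool // IsFeasible G M})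

/-- The configuration in which every link is inactive. -/
instance {n : ℕ} (G : SimpleGraph (Fin n)) (c : ℕ) : Nonempty (Config G c) :=
  ⟨⟨fun _ _ => false, by constructor <;> simp⟩⟩

/-- Number `k` of successful transmissions among the `m` packets of a slot, on every link and
channel; the reward on link `i` and channel `j` is `k i j / m`. -/
abbrev Outcome (n c m : ℕ) := Fin n → Fin c → Fin (m + 1)

/-- Binomial distribution `Bin(m, p)`, on `{0, …, m}`. -/
def binPMF (m : ℕ) (p : unitInterval) : PMF (Fin (m + 1)) :=
  PMF.ofFintype
    (fun k => ENNReal.ofReal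
      ((m.choose k : ℝ) * (p : ℝ) ^ (k : ℕ) * (1 - (p : ℝ)) ^ (m - (k : ℕ)))) (by
    have h0 : (0 : ℝ) ≤ p := p.2.1
    have h1 : (0 : ℝ) ≤ 1 - p := sub_nonneg.2 p.2.2
    rw [← ENNReal.ofReal_sum_of_nonneg (fun k _ => by positivity),
      Fin.sum_univ_eq_sum_range
        (fun k => (m.choose k : ℝ) * (p : ℝ) ^ k * (1 - (p : ℝ)) ^ (m - k)) (m + 1)]
    have h := add_pow (p : ℝ) (1 - p) m
    rw [add_sub_cancel, one_pow] at h
    rw [ENNReal.ofReal_eq_one]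
    refine Eq.trans ?_ h.symm
    exact Finset.sum_congr rfl fun k _ => by ring)

/-- Law of the outcome of one slot: the entries are independent, with law `Bin(m, θ i j)`. -/
def outcomePMF {n c : ℕ} (m : ℕ) (θ : Param n c) : PMF (Outcome n c m) :=
  PMF.ofFintype (fun k => ∏ i, ∏ j, binPMF m (θ i j) (k i j)) (by
    have h : ∀ i, ∑ k : Fin c → Fin (m + 1), ∏ j, binPMF m (θ i j) (k j) = 1 := fun i => by
      rw [← Fintype.prod_sum]
      exact Finset.prod_eq_one fun j _ => by
        rw [← tsum_fintype (L := .unconditional _)]; exact PMF.tsum_coe _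
    rw [← Fintype.prod_sum fun i (k : Fin c → Fin (m + 1)) => ∏ j, binPMF m (θ i j) (k j)]
    exact Finset.prod_eq_one fun i _ => h i)

section
variable {n c : ℕ} {G : SimpleGraph (Fin n)} {m : ℕ}

/-- `r_M = M • r`: the total reward of a slot with outcome `k` under configuration `M`. -/
def slotReward (M : Config G c) (k : Outcome n c m) : ℝ :=
  ∑ i, ∑ j, if M.1 i j = true then ((k i j : ℕ) : ℝ) / m else 0

/-- Detailed feedback: the rewards of exactly the pairs (link, channel) in the configuration. -/
def detailedFeedback (M : Config G c) (k : Outcome n c m) : Fin n → Fin c → Option (Fin (m + 1)) :=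
  fun i j => if M.1 i j = true then some (k i j) else none

/-- Randomised policies with detailed feedback: after `t` slots, the past configurations and the
past feedback determine the distribution of the next configuration. -/
def Policy {n : ℕ} (G : SimpleGraph (Fin n)) (c m : ℕ) :=
  (t : ℕ) → (Fin t → Config G c × (Fin n → Fin c → Option (Fin (m + 1)))) → PMF (Config G c)

/-- Law, under parameter `θ` and policy `π`, of the selected configurations and of the outcomes
(observed or not) of the first `T` slots. In each slot the configuration is drawn according to the
policy, and the outcome is drawn afresh, independently of the past and of the configuration. -/
def law (π : Policy G c m) (θ : Param n c) :
    (T : ℕ) → PMF (Fin T → Config G c × Outcome n c m)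
  | 0 => PMF.pure Fin.elim0
  | T + 1 => (law π θ T).bind fun h =>
      (π T fun s => ((h s).1, detailedFeedback (h s).1 (h s).2)).bind fun M =>
        (outcomePMF m θ).bind fun k =>
          PMF.pure (Fin.snoc (α := fun _ => Config G c × Outcome n c m) h (M, k))

/-- Expectation of a function of the first `T` slots. -/
def expect (π : Policy G c m) (θ : Param n c) (T : ℕ)
    (f : (Fin T → Config G c × Outcome n c m) → ℝ) : ℝ :=
  ∑ h, (law π θ T h).toReal * f h

/-- The regret `R^π(T) = max_M E[∑_{t ≤ T} r_M(t)] - E[∑_{t ≤ T} r_{M^π(t)}(t)]`. -/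
def regret (π : Policy G c m) (θ : Param n c) (T : ℕ) : ℝ :=
  (Finset.univ.sup' Finset.univ_nonempty fun M : Config G c =>
      expect π θ T fun h => ∑ s, slotReward M (h s).2) -
    expect π θ T fun h => ∑ s, slotReward (h s).1 (h s).2

/-- `E[T_M(T)]`: expected number of times `M` is selected in the first `T` slots. -/
def expectedCount (π : Policy G c m) (θ : Param n c) (M : Config G c) (T : ℕ) : ℝ :=
  expect π θ T fun h => ((Finset.univ.filter fun s => (h s).1 = M).card : ℝ)

/-- `μ^M(θ) = M • θ`. -/
def mean (M : Config G c) (θ : Param n c) : ℝ :=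
  ∑ i, ∑ j, if M.1 i j = true then (θ i j : ℝ) else 0

variable (G) in
/-- `μ^⋆ = max_M μ^M(θ)`. -/
def optMean (θ : Param n c) : ℝ :=
  Finset.univ.sup' Finset.univ_nonempty fun M : Config G c => mean M θ

/-- `Mstar` is the unique optimal configuration under `θ`. -/
def IsUniqueOptimal (θ : Param n c) (Mstar : Config G c) : Prop :=
  ∀ M, M ≠ Mstar → mean M θ < mean Mstar θ

/-- Uniformly good policies: whatever the parameter (with a unique optimal configuration), every
sub-optimal configuration is selected `o(t ^ γ)` times in expectation, for all `γ > 0`. -/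
def UniformlyGood (π : Policy G c m) : Prop :=
  ∀ (θ : Param n c) (Mstar : Config G c), IsUniqueOptimal θ Mstar →
    ∀ M, M ≠ Mstar → ∀ γ : ℝ, 0 < γ →
      (fun t : ℕ => expectedCount π θ M t) =o[atTop] fun t : ℕ => (t : ℝ) ^ γ

/-- `B_M(θ)`: the parameters that agree with `θ` on the optimal configuration `Mstar`, and under
which `M` performs better than `μ^⋆`. -/
def badSet (θ : Param n c) (Mstar M : Config G c) : Set (Param n c) :=
  {lam | (∀ i j, Mstar.1 i j = true → lam i j = θ i j) ∧ optMean G θ < mean M lam}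

open Classical in
/-- `p_i(· ; M, θ)`: law of the number of packets successfully transmitted on link `i` under
configuration `M`: binomial with parameter `θ i j` if `j` is the (unique) channel used by link `i`,
and the point mass at `0` if link `i` is inactive. -/
def linkPMF (m : ℕ) (M : Config G c) (θ : Param n c) (i : Fin n) : PMF (Fin (m + 1)) :=
  if h : ∃ j, M.1 i j = true then binPMF m (θ i h.choose) else PMF.pure 0

theorem linkPMF_of_active (m : ℕ) (M : Config G c) (θ : Param n c) {i : Fin n} {j : Fin c}
    (hj : M.1 i j = true) : linkPMF m M θ i = binPMF m (θ i j) := by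
  have h : ∃ j, M.1 i j = true := ⟨j, hj⟩
  rw [linkPMF, dif_pos h, M.2.1 i _ _ h.choose_spec hj]

/-- `KL^M(θ, λ)`, the sum over the links of the Kullback-Leibler divergences of their laws, with values in `[0, ∞]`. -/
def KL (m : ℕ) (M : Config G c) (θ lam : Param n c) : ℝ≥0∞ :=
  ∑ i, InformationTheory.klDiv (linkPMF m M θ i).toMeasure (linkPMF m M lam i).toMeasure

variable (m) in
/-- The exploration rates `x` that satisfy the constraints of the optimisation problem. -/
def feasibleRates (θ : Param n c) (Mstar : Config G c) : Set (Config G c → ℝ≥0) :=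
  {x | ∀ M, M ≠ Mstar →
    1 ≤ ⨅ lam ∈ badSet θ Mstar M, ∑ Q ∈ Finset.univ.erase Mstar, (x Q : ℝ≥0∞) * KL m Q θ lam}

variable (m) in
/-- `C(θ)`: the value of the optimisation problem. -/
def C (θ : Param n c) (Mstar : Config G c) : EReal :=
  ⨅ x ∈ feasibleRates m θ Mstar,
    ((∑ M : Config G c, (x M : ℝ) * (optMean G θ - mean M θ) : ℝ) : EReal)

end

end SpectrumBandit

end

/-! ### Finite sums against PMFs and the mean of the binomial law -/

namespace SpectrumBandit

/-! By Wald's identity the regret is the sum of `E[T_M]` times the gap of `M` (`regret_eq`). If the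
liminf were below some `b < C(θ)`, then along an ultrafilter on which regret over `log T` stays
below `b`, every rate `E[T_Q] / log T` with `Q ≠ Mstar` is bounded, hence converges to some `x Q`.
The limit has objective at most `b`, so a contradiction follows once `x` is feasible
(`mem_feasibleRates_of_tendsto`).

Feasibility is a change of measure. Let `lam` agree with `θ` on `Mstar` but have another unique
optimum. A uniformly good policy plays `Mstar` almost always under `θ` and only `O(T ^ γ)` times
under `lam`. The Donsker-Varadhan bound `mul_expectedCount_le`, applied to the fraction of slots
spent on `Mstar`, turns this into at least `(1 - γ) log T` of information up to a bounded term.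
Slots spent on `Mstar` carry none of it, so `∑ x Q * KL^Q ≥ 1` (`one_le_sum_mul_configDiv`).

A general `lam` in `badSet` may lie on the boundary or have tied optima. It is moved outside `Mstar`
by powers `± t ^ k` with distinct exponents, which puts those entries in `(0, 1)` and separates the
means of configurations that differ outside `Mstar`. The remaining ties are excluded by a union
argument (`eq_of_forall_mean_le`). Then `t → 0`, using continuity of the divergences. -/

theorem sum_toReal_eq_one {α : Type*} [Fintype α] (p : PMF α) : ∑ a, (p a).toReal = 1 := by
  rw [← ENNReal.toReal_sum fun a _ => p.apply_ne_top a, ← tsum_fintype (L := .unconditional _),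
    p.tsum_coe, ENNReal.toReal_one]

theorem sum_bind_toReal_mul {α β : Type*} [Fintype α] [Fintype β] (p : PMF α) (q : α → PMF β)
    (f : β → ℝ) :
    ∑ b, (p.bind q b).toReal * f b = ∑ a, (p a).toReal * ∑ b, (q a b).toReal * f b := by
  have h : ∀ b, (p.bind q b).toReal = ∑ a, (p a).toReal * (q a b).toReal := fun b => by
    rw [PMF.bind_apply, tsum_fintype, ENNReal.toReal_sum fun a _ =>
      ENNReal.mul_ne_top (p.apply_ne_top a) ((q a).apply_ne_top b)]
    simp only [ENNReal.toReal_mul]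
  simp only [h, Finset.sum_mul, Finset.mul_sum]
  rw [Finset.sum_comm]
  simp only [mul_assoc]

theorem sum_pure_toReal_mul {β : Type*} [Fintype β] (x : β) (f : β → ℝ) :
    ∑ b, (PMF.pure x b).toReal * f b = f x := by
  classical
  rw [Finset.sum_eq_single x]
  · simp
  · intro b _ hb
    simp [PMF.pure_apply, hb]
  · simp

/-- Probability of `k` under `Bin(m, p)`, as a real number. -/
noncomputable def binWeight (m : ℕ) (p : unitInterval) (k : Fin (m + 1)) : ℝ :=
  (binPMF m p k).toReal

theorem binWeight_eq (m : ℕ) (p : unitInterval) (k : Fin (m + 1)) :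
    binWeight m p k = (m.choose k : ℝ) * (p : ℝ) ^ (k : ℕ) * (1 - (p : ℝ)) ^ (m - (k : ℕ)) := by
  have h0 : (0 : ℝ) ≤ p := p.2.1
  have h1 : (0 : ℝ) ≤ 1 - p := sub_nonneg.2 p.2.2
  rw [binWeight, binPMF, PMF.ofFintype_apply, ENNReal.toReal_ofReal (by positivity)]

theorem binWeight_nonneg (m : ℕ) (p : unitInterval) (k : Fin (m + 1)) : 0 ≤ binWeight m p k :=
  ENNReal.toReal_nonneg

theorem sum_binWeight (m : ℕ) (p : unitInterval) : ∑ k, binWeight m p k = 1 :=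
  sum_toReal_eq_one _

theorem sum_binWeight_mul_id (m : ℕ) (p : unitInterval) :
    ∑ k, binWeight m p k * ((k : ℕ) : ℝ) = m * p := by
  simp only [binWeight_eq]
  rw [Fin.sum_univ_eq_sum_range
    (fun k => (m.choose k : ℝ) * (p : ℝ) ^ k * (1 - (p : ℝ)) ^ (m - k) * (k : ℝ)) (m + 1)]
  -- The binomial weights are the Bernstein polynomials evaluated at `p`.
  have h := congrArg (Polynomial.eval (p : ℝ)) (bernsteinPolynomial.sum_smul ℝ m)
  simp only [Polynomial.eval_finsetSum, bernsteinPolynomial, Polynomial.eval_smul] at h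
  simp only [nsmul_eq_mul, Polynomial.eval_mul, Polynomial.eval_natCast, Polynomial.eval_pow,
    Polynomial.eval_X, Polynomial.eval_sub, Polynomial.eval_one] at h
  rw [← h]
  exact Finset.sum_congr rfl fun k _ => by ring

/-! ### The outcome of one slot -/

section
variable {n c m : ℕ} {G : SimpleGraph (Fin n)}

/-- Expectation of a function of the outcome of one slot. -/
noncomputable def outcomeExpect (θ : Param n c) (f : Outcome n c m → ℝ) : ℝ :=
  ∑ k, (outcomePMF m θ k).toReal * f k

theorem outcomePMF_toReal (θ : Param n c) (k : Outcome n c m) :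
    (outcomePMF m θ k).toReal = ∏ i, ∏ j, binWeight m (θ i j) (k i j) := by
  simp [outcomePMF, PMF.ofFintype_apply, ENNReal.toReal_prod, binWeight]

theorem outcomeExpect_const (θ : Param n c) (a : ℝ) :
    outcomeExpect (m := m) θ (fun _ => a) = a := by
  rw [outcomeExpect, ← Finset.sum_mul, sum_toReal_eq_one, one_mul]

theorem outcomeExpect_add (θ : Param n c) (f g : Outcome n c m → ℝ) :
    outcomeExpect θ (fun k => f k + g k) = outcomeExpect θ f + outcomeExpect θ g := by
  simp only [outcomeExpect, mul_add, Finset.sum_add_distrib]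

theorem outcomeExpect_sum {ι : Type*} (s : Finset ι) (θ : Param n c) (f : ι → Outcome n c m → ℝ) :
    outcomeExpect θ (fun k => ∑ i ∈ s, f i k) = ∑ i ∈ s, outcomeExpect θ (f i) := by
  simp only [outcomeExpect, Finset.mul_sum]
  rw [Finset.sum_comm]

theorem outcomeExpect_mul_left (θ : Param n c) (a : ℝ) (f : Outcome n c m → ℝ) :
    outcomeExpect θ (fun k => a * f k) = a * outcomeExpect θ f := by
  simp only [outcomeExpect, Finset.mul_sum]
  exact Finset.sum_congr rfl fun k _ => by ring

theorem sum_outcome_prod (f : Fin n → Fin c → Fin (m + 1) → ℝ) :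
    ∑ k : Outcome n c m, ∏ i, ∏ j, f i j (k i j) = ∏ i, ∏ j, ∑ y, f i j y := by
  have h : ∀ i, ∏ j, ∑ y, f i j y = ∑ k : Fin c → Fin (m + 1), ∏ j, f i j (k j) :=
    fun i => Fintype.prod_sum _
  simp only [h]
  rw [Fintype.prod_sum fun i (k : Fin c → Fin (m + 1)) => ∏ j, f i j (k j)]

theorem outcomeExpect_prod (θ : Param n c) (f : Fin n → Fin c → Fin (m + 1) → ℝ) :
    outcomeExpect θ (fun k => ∏ i, ∏ j, f i j (k i j)) =
      ∏ i, ∏ j, ∑ y, binWeight m (θ i j) y * f i j y := by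
  simp only [outcomeExpect, outcomePMF_toReal, ← Finset.prod_mul_distrib]
  rw [← sum_outcome_prod]

theorem outcomeExpect_entry (θ : Param n c) (i : Fin n) (j : Fin c) (f : Fin (m + 1) → ℝ) :
    outcomeExpect θ (fun k => f (k i j)) = ∑ y, binWeight m (θ i j) y * f y := by
  -- A product whose factors are all `1` except at `(i, j)`.
  have h := outcomeExpect_prod (m := m) θ fun i' j' y => if i' = i then if j' = j then f y else 1 else 1
  have h1 : ∀ k : Outcome n c m,
      (∏ i', ∏ j', if i' = i then if j' = j then f (k i' j') else 1 else 1) = f (k i j) := by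
    intro k
    rw [Finset.prod_eq_single i (fun b _ hb => by simp [hb]) (by simp),
      Finset.prod_eq_single j (fun b _ hb => by simp [hb]) (by simp)]
    simp
  simp only [h1] at h
  rw [h, Finset.prod_eq_single i (fun b _ hb => by simp [hb, sum_binWeight]) (by simp),
      Finset.prod_eq_single j (fun b _ hb => by simp [hb, sum_binWeight]) (by simp)]
  simp

theorem outcomeExpect_slotReward (hm : 0 < m) (θ : Param n c) (M : Config G c) :
    outcomeExpect (m := m) θ (slotReward M) = mean M θ := by
  unfold slotReward mean
  simp only [outcomeExpect_sum]
  refine Finset.sum_congr rfl fun i _ => Finset.sum_congr rfl fun j _ => ?_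
  by_cases hM : M.1 i j = true
  · simp only [hM, if_true]
    rw [outcomeExpect_entry θ i j (fun y => ((y : ℕ) : ℝ) / m)]
    simp only [← mul_div_assoc]
    rw [← Finset.sum_div, sum_binWeight_mul_id]
    have : (m : ℝ) ≠ 0 := by positivity
    field_simp
  · simp only [hM]
    exact outcomeExpect_const θ 0

/-- Parameters that agree on a configuration give the same law to its detailed feedback. -/
theorem outcomeExpect_detailedFeedback_congr {θ lam : Param n c} {M : Config G c}
    (h : ∀ i j, M.1 i j = true → θ i j = lam i j)
    (F : (Fin n → Fin c → Option (Fin (m + 1))) → ℝ) :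
    outcomeExpect θ (fun k => F (detailedFeedback M k)) =
      outcomeExpect lam fun k => F (detailedFeedback M k) := by
  -- Indicators of a feedback value factor over the entries, and factors outside `M` do not depend
  -- on the outcome; a general `F` is a linear combination of these.
  have key : ∀ o : Fin n → Fin c → Option (Fin (m + 1)),
      outcomeExpect θ (fun k => if detailedFeedback M k = o then 1 else 0) =
        outcomeExpect lam fun k => if detailedFeedback M k = o then 1 else 0 := by
    intro o
    have h1 : ∀ k : Outcome n c m, (if detailedFeedback M k = o then (1 : ℝ) else 0) =
        ∏ i, ∏ j, if (if M.1 i j = true then some (k i j) else none) = o i j then 1 else 0 := by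
      intro k
      by_cases hk : detailedFeedback M k = o
      · rw [if_pos hk]
        refine (Finset.prod_eq_one fun i _ => Finset.prod_eq_one fun j _ => ?_).symm
        rw [if_pos]
        rw [← hk, detailedFeedback]
      · rw [if_neg hk]
        obtain ⟨i, hi⟩ := Function.ne_iff.1 hk
        obtain ⟨j, hj⟩ := Function.ne_iff.1 hi
        refine (Finset.prod_eq_zero (Finset.mem_univ i)
          (Finset.prod_eq_zero (Finset.mem_univ j) ?_)).symm
        rw [if_neg]
        exact hj
    simp only [h1]
    rw [outcomeExpect_prod θ fun i j y =>
        if (if M.1 i j = true then some y else none) = o i j then 1 else 0,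
      outcomeExpect_prod lam fun i j y =>
        if (if M.1 i j = true then some y else none) = o i j then 1 else 0]
    refine Finset.prod_congr rfl fun i _ => Finset.prod_congr rfl fun j _ => ?_
    by_cases hM : M.1 i j = true
    · rw [h i j hM]
    · simp only [if_neg hM, ← Finset.sum_mul, sum_binWeight]
  have hF : ∀ k : Outcome n c m, F (detailedFeedback M k) =
      ∑ o, F o * if detailedFeedback M k = o then 1 else 0 := by
    intro k
    simp
  simp only [hF, outcomeExpect_sum, outcomeExpect_mul_left, key]

/-- What the policy sees of a history. -/
def observed {T : ℕ} (h : Fin T → Config G c × Outcome n c m) :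
    Fin T → Config G c × (Fin n → Fin c → Option (Fin (m + 1))) :=
  fun s => ((h s).1, detailedFeedback (h s).1 (h s).2)

/-! ### Expectations over histories, Wald's identity and the regret decomposition -/

variable (π : Policy G c m) (θ : Param n c)

theorem expect_zero (f : (Fin 0 → Config G c × Outcome n c m) → ℝ) :
    expect π θ 0 f = f Fin.elim0 :=
  sum_pure_toReal_mul _ _

theorem expect_succ (T : ℕ) (f : (Fin (T + 1) → Config G c × Outcome n c m) → ℝ) :
    expect π θ (T + 1) f = expect π θ T fun h => ∑ M, (π T (observed h) M).toReal *
      outcomeExpect θ fun k =>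
        f (Fin.snoc (α := fun _ => Config G c × Outcome n c m) h (M, k)) := by
  simp only [expect, law, sum_bind_toReal_mul, sum_pure_toReal_mul, outcomeExpect]
  rfl

theorem expect_add (T : ℕ) (f g : (Fin T → Config G c × Outcome n c m) → ℝ) :
    expect π θ T (fun h => f h + g h) = expect π θ T f + expect π θ T g := by
  simp only [expect, mul_add, Finset.sum_add_distrib]

theorem expect_mul_left (T : ℕ) (a : ℝ) (f : (Fin T → Config G c × Outcome n c m) → ℝ) :
    expect π θ T (fun h => a * f h) = a * expect π θ T f := by
  simp only [expect, Finset.mul_sum]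
  exact Finset.sum_congr rfl fun k _ => by ring

theorem expect_sum {ι : Type*} (s : Finset ι) (T : ℕ)
    (f : ι → (Fin T → Config G c × Outcome n c m) → ℝ) :
    expect π θ T (fun h => ∑ i ∈ s, f i h) = ∑ i ∈ s, expect π θ T (f i) := by
  simp only [expect, Finset.mul_sum]
  rw [Finset.sum_comm]

theorem expect_const (T : ℕ) (a : ℝ) : expect π θ T (fun _ => a) = a := by
  rw [expect, ← Finset.sum_mul, sum_toReal_eq_one, one_mul]

theorem expect_mono {T : ℕ} {f g : (Fin T → Config G c × Outcome n c m) → ℝ}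
    (h : ∀ x, f x ≤ g x) : expect π θ T f ≤ expect π θ T g :=
  Finset.sum_le_sum fun k _ => mul_le_mul_of_nonneg_left (h k) ENNReal.toReal_nonneg

theorem exp_expect_le (T : ℕ) (f : (Fin T → Config G c × Outcome n c m) → ℝ) :
    Real.exp (expect π θ T f) ≤ expect π θ T fun h => Real.exp (f h) := by
  have := convexOn_exp.map_sum_le (t := Finset.univ) (w := fun h => (law π θ T h).toReal) (p := f)
    (fun _ _ => ENNReal.toReal_nonneg) (sum_toReal_eq_one _) (fun _ _ => Set.mem_univ _)
  simpa [expect] using this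

theorem expect_sum_slots_succ (T : ℕ) (φ : Config G c → Outcome n c m → ℝ) :
    expect π θ (T + 1) (fun h => ∑ s, φ (h s).1 (h s).2) =
      expect π θ T (fun h => ∑ s, φ (h s).1 (h s).2) +
        ∑ M, expect π θ T (fun h => (π T (observed h) M).toReal) * outcomeExpect θ (φ M) := by
  rw [expect_succ]
  simp only [Fin.sum_univ_castSucc, Fin.snoc_castSucc, Fin.snoc_last, outcomeExpect_add,
    outcomeExpect_const, mul_add, Finset.sum_add_distrib, ← Finset.sum_mul, sum_toReal_eq_one,
    one_mul]
  rw [expect_add]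
  refine congrArg₂ _ rfl ((expect_sum π θ _ T _).trans (Finset.sum_congr rfl fun M _ => ?_))
  rw [mul_comm, ← expect_mul_left]
  simp only [mul_comm]

theorem expectedCount_eq (M : Config G c) (T : ℕ) :
    expectedCount π θ M T = expect π θ T fun h => ∑ s, if (h s).1 = M then 1 else 0 := by
  simp [expectedCount]

theorem expectedCount_zero (M : Config G c) : expectedCount π θ M 0 = 0 := by
  simp [expectedCount_eq, expect_zero]

theorem expectedCount_succ (M : Config G c) (T : ℕ) :
    expectedCount π θ M (T + 1) =
      expectedCount π θ M T + expect π θ T fun h => (π T (observed h) M).toReal := by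
  rw [expectedCount_eq, expectedCount_eq,
    expect_sum_slots_succ π θ T fun N _ => if N = M then 1 else 0]
  simp only [outcomeExpect_const]
  simp

/-- Wald's identity. -/
theorem expect_sum_slots (T : ℕ) (φ : Config G c → Outcome n c m → ℝ) :
    expect π θ T (fun h => ∑ s, φ (h s).1 (h s).2) =
      ∑ M, expectedCount π θ M T * outcomeExpect θ (φ M) := by
  induction T with
  | zero => simp [expect_zero, expectedCount_zero]
  | succ T ih =>
    rw [expect_sum_slots_succ, ih]
    simp only [expectedCount_succ, add_mul, Finset.sum_add_distrib]

theorem sum_expectedCount (T : ℕ) : ∑ M, expectedCount π θ M T = T := by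
  have h := expect_sum_slots π θ T fun _ _ => 1
  simp only [outcomeExpect_const, mul_one] at h
  rw [← h, expect_const]
  simp

theorem expectedCount_nonneg (M : Config G c) (T : ℕ) : 0 ≤ expectedCount π θ M T := by
  rw [← expect_const π θ T 0]
  exact expect_mono π θ fun h => Nat.cast_nonneg _

theorem mean_le_optMean (M : Config G c) : mean M θ ≤ optMean G θ :=
  Finset.le_sup' (fun M => mean M θ) (Finset.mem_univ M)

theorem regret_eq (hm : 0 < m) (T : ℕ) :
    regret π θ T = ∑ M, expectedCount π θ M T * (optMean G θ - mean M θ) := by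
  have h1 : ∀ M : Config G c,
      expect π θ T (fun h => ∑ s, slotReward M (h s).2) = T * mean M θ := fun M => by
    rw [expect_sum_slots π θ T fun _ => slotReward M]
    simp only [outcomeExpect_slotReward hm, ← Finset.sum_mul, sum_expectedCount]
  have h2 : expect π θ T (fun h => ∑ s, slotReward (h s).1 (h s).2) =
      ∑ M, expectedCount π θ M T * mean M θ := by
    rw [expect_sum_slots π θ T slotReward]
    simp only [outcomeExpect_slotReward hm]
  have h3 : (Finset.univ.sup' Finset.univ_nonempty fun M : Config G c => T * mean M θ) =
      T * optMean G θ := by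
    apply le_antisymm
    · exact Finset.sup'_le _ _ fun M _ =>
        mul_le_mul_of_nonneg_left (mean_le_optMean θ M) (Nat.cast_nonneg _)
    · obtain ⟨M, -, hM⟩ := Finset.exists_mem_eq_sup' (Finset.univ_nonempty (α := Config G c))
        fun M => mean M θ
      rw [optMean, hM]
      exact Finset.le_sup' (fun M : Config G c => (T : ℝ) * mean M θ) (Finset.mem_univ M)
  simp only [regret, h1, h2, h3, mul_sub, Finset.sum_sub_distrib, ← Finset.sum_mul,
    sum_expectedCount]

end

/-! ### Change of measure and the information inequality -/

section
variable {n c m : ℕ} {G : SimpleGraph (Fin n)}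

/-- Log-likelihood ratio of `θ` against `lam` of the feedback of one slot. -/
noncomputable def logRatio (θ lam : Param n c) (M : Config G c) (k : Outcome n c m) : ℝ :=
  ∑ i, ∑ j, if M.1 i j = true then
    Real.log (binWeight m (θ i j) (k i j) / binWeight m (lam i j) (k i j)) else 0

/-- `Bin(m, p)` is absolutely continuous with respect to `Bin(m, q)`. -/
def BinAC (m : ℕ) (p q : unitInterval) : Prop :=
  ∀ k, binWeight m q k = 0 → binWeight m p k = 0

/-- Kullback-Leibler divergence of binomial distributions, as a real number. -/
noncomputable def binDiv (m : ℕ) (p q : unitInterval) : ℝ :=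
  ∑ k, binWeight m p k * Real.log (binWeight m p k / binWeight m q k)

theorem outcomeExpect_logRatio (θ lam : Param n c) (M : Config G c) :
    outcomeExpect (m := m) θ (logRatio θ lam M) =
      ∑ i, ∑ j, if M.1 i j = true then binDiv m (θ i j) (lam i j) else 0 := by
  unfold logRatio
  simp only [outcomeExpect_sum]
  refine Finset.sum_congr rfl fun i _ => Finset.sum_congr rfl fun j _ => ?_
  by_cases hM : M.1 i j = true
  · simp only [hM, if_true]
    exact outcomeExpect_entry θ i j
      (fun y => Real.log (binWeight m (θ i j) y / binWeight m (lam i j) y))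
  · simp only [if_neg hM]
    exact outcomeExpect_const θ 0

/-- Only an inequality: outcomes that are null under `θ` but not under `lam` contribute nothing on
the left. -/
theorem outcomeExpect_exp_neg_logRatio_le {θ lam : Param n c}
    (hac : ∀ i j, BinAC m (θ i j) (lam i j)) (M : Config G c)
    (F : (Fin n → Fin c → Option (Fin (m + 1))) → ℝ) (hF : ∀ o, 0 ≤ F o) :
    outcomeExpect θ (fun k => Real.exp (-logRatio θ lam M k) * F (detailedFeedback M k)) ≤
      outcomeExpect lam fun k => F (detailedFeedback M k) := by
  -- The feedback of `M` cannot tell `lam` from this hybrid, and against the hybrid the comparison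
  -- holds outcome by outcome.
  let θ' : Param n c := fun i j => if M.1 i j = true then lam i j else θ i j
  rw [← outcomeExpect_detailedFeedback_congr (θ := θ') (lam := lam) (M := M)
    (fun i j hM => if_pos hM) F]
  refine Finset.sum_le_sum fun k _ => ?_
  rw [← mul_assoc]
  refine mul_le_mul_of_nonneg_right ?_ (hF _)
  rw [outcomePMF_toReal, outcomePMF_toReal, logRatio, ← Finset.sum_neg_distrib, Real.exp_sum,
    ← Finset.prod_mul_distrib]
  refine Finset.prod_le_prod (fun i _ => mul_nonneg
    (Finset.prod_nonneg fun j _ => binWeight_nonneg _ _ _) (Real.exp_pos _).le) fun i _ => ?_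
  rw [← Finset.sum_neg_distrib, Real.exp_sum, ← Finset.prod_mul_distrib]
  refine Finset.prod_le_prod (fun j _ => mul_nonneg (binWeight_nonneg _ _ _)
    (Real.exp_pos _).le) fun j _ => ?_
  by_cases hM : M.1 i j = true
  · simp only [θ', if_pos hM]
    rcases (binWeight_nonneg m (θ i j) (k i j)).eq_or_lt with h0 | hpos
    · rw [← h0, zero_mul]
      exact binWeight_nonneg _ _ _
    · have hpos' : 0 < binWeight m (lam i j) (k i j) :=
        (binWeight_nonneg _ _ _).lt_of_ne' fun h => hpos.ne' (hac i j _ h)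
      rw [Real.exp_neg, Real.exp_log (div_pos hpos hpos'), inv_div, mul_div_cancel₀ _ hpos.ne']
  · simp only [θ', if_neg hM]
    simp

/-- Change of measure, for nonnegative functions of the observations. -/
theorem expect_exp_neg_logRatio_le (π : Policy G c m) {θ lam : Param n c}
    (hac : ∀ i j, BinAC m (θ i j) (lam i j)) (T : ℕ)
    (g : (Fin T → Config G c × (Fin n → Fin c → Option (Fin (m + 1)))) → ℝ) (hg : ∀ o, 0 ≤ g o) :
    expect π θ T (fun h => Real.exp (-∑ s, logRatio θ lam (h s).1 (h s).2) * g (observed h)) ≤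
      expect π lam T fun h => g (observed h) := by
  induction T with
  | zero => simp [expect_zero, Subsingleton.elim _ Fin.elim0]
  | succ T ih =>
    have hsnoc : ∀ (h : Fin T → Config G c × Outcome n c m) (M : Config G c) (k : Outcome n c m),
        observed (Fin.snoc (α := fun _ => Config G c × Outcome n c m) h (M, k)) =
          Fin.snoc (α := fun _ => Config G c × (Fin n → Fin c → Option (Fin (m + 1))))
            (observed h) (M, detailedFeedback M k) := by
      intro h M k
      funext s
      refine Fin.lastCases ?_ (fun s => ?_) s <;> simp [observed]
    rw [expect_succ, expect_succ]
    simp only [hsnoc, Fin.sum_univ_castSucc, Fin.snoc_castSucc, Fin.snoc_last, neg_add,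
      Real.exp_add]
    -- The induction hypothesis is applied to `g` averaged over the last slot under `lam`; the
    -- policy's probabilities are common to both sides.
    refine le_trans (expect_mono π θ fun h => ?_)
      (ih (fun o => ∑ M, (π T o M).toReal * outcomeExpect lam fun k =>
        g (Fin.snoc (α := fun _ => Config G c × (Fin n → Fin c → Option (Fin (m + 1)))) o
          (M, detailedFeedback M k))) fun o => ?_)
    · rw [Finset.mul_sum]
      refine Finset.sum_le_sum fun M _ => ?_
      simp only [mul_assoc, outcomeExpect_mul_left]
      rw [mul_left_comm]
      refine mul_le_mul_of_nonneg_left (mul_le_mul_of_nonneg_left ?_ ENNReal.toReal_nonneg)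
        (Real.exp_pos _).le
      exact outcomeExpect_exp_neg_logRatio_le hac M (fun y => g (Fin.snoc (α := fun _ =>
        Config G c × (Fin n → Fin c → Option (Fin (m + 1)))) (observed h) (M, y))) fun _ => hg _
    · exact Finset.sum_nonneg fun M _ => mul_nonneg ENNReal.toReal_nonneg
        (Finset.sum_nonneg fun k _ => mul_nonneg ENNReal.toReal_nonneg (hg _))

/-- `KL^M(θ, lam)` as a real number, meaningful under absolute continuity. -/
noncomputable def configDiv (m : ℕ) (M : Config G c) (θ lam : Param n c) : ℝ :=
  ∑ i, ∑ j, if M.1 i j = true then binDiv m (θ i j) (lam i j) else 0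

/-- The convex function `exp` lies below its chord between `0` and `a`. -/
theorem exp_mul_le_one_add {a z : ℝ} (h0 : 0 ≤ z) (h1 : z ≤ 1) :
    Real.exp (a * z) ≤ 1 + z * (Real.exp a - 1) := by
  have := convexOn_exp.2 (Set.mem_univ 0) (Set.mem_univ a) (sub_nonneg.2 h1) h0 (by ring)
  simp only [smul_eq_mul, mul_zero, zero_add, Real.exp_zero, mul_one] at this
  rw [mul_comm a z]
  linarith

/-- The information inequality, for the fraction of slots in which `M` is selected. -/
theorem mul_expectedCount_le (π : Policy G c m) {θ lam : Param n c}
    (hac : ∀ i j, BinAC m (θ i j) (lam i j)) {T : ℕ} (hT : 0 < T) (M : Config G c) (a : ℝ) :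
    a * (expectedCount π θ M T / T) ≤
      ∑ Q, expectedCount π θ Q T * configDiv m Q θ lam +
        Real.log (1 + expectedCount π lam M T / T * (Real.exp a - 1)) := by
  have hT' : (0 : ℝ) < T := Nat.cast_pos.2 hT
  obtain ⟨Z, hZ, hZ0, hZ1⟩ :
      ∃ Z : (Fin T → Config G c × (Fin n → Fin c → Option (Fin (m + 1)))) → ℝ,
        (∀ θ' : Param n c, expect π θ' T (fun h => Z (observed h)) =
          expectedCount π θ' M T / T) ∧ (∀ o, 0 ≤ Z o) ∧ ∀ o, Z o ≤ 1 := by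
    refine ⟨fun o => (T : ℝ)⁻¹ * ((Finset.univ.filter fun s => (o s).1 = M).card : ℝ),
      fun θ' => ?_, fun o => by positivity, fun o => ?_⟩
    · rw [expect_mul_left, div_eq_inv_mul]
      rfl
    · have h := Finset.card_filter_le (Finset.univ : Finset (Fin T)) fun s => (o s).1 = M
      rw [Finset.card_univ, Fintype.card_fin] at h
      rw [← inv_mul_cancel₀ hT'.ne']
      exact mul_le_mul_of_nonneg_left (Nat.cast_le.2 h) (by positivity)
  have hL := expect_sum_slots π θ T (logRatio θ lam)
  simp only [outcomeExpect_logRatio] at hL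
  -- Jensen for `a * Z` minus the log-likelihood ratio; the change of measure then removes the
  -- ratio.
  have h1 := exp_expect_le π θ T fun h =>
    a * Z (observed h) + -1 * ∑ s, logRatio θ lam (h s).1 (h s).2
  rw [expect_add, expect_mul_left, expect_mul_left, hZ, hL] at h1
  have h2 := expect_exp_neg_logRatio_le π hac T (fun o => Real.exp (a * Z o))
    fun o => (Real.exp_pos _).le
  have h3 : expect π lam T (fun h => Real.exp (a * Z (observed h))) ≤
      1 + expectedCount π lam M T / T * (Real.exp a - 1) := by
    refine (expect_mono π lam fun h =>
      exp_mul_le_one_add (a := a) (hZ0 (observed h)) (hZ1 (observed h))).trans_eq ?_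
    simp only [mul_comm _ (Real.exp a - 1)]
    rw [expect_add, expect_const, expect_mul_left, hZ]
  simp only [neg_one_mul, Real.exp_add, mul_comm (Real.exp (a * Z _))] at h1
  have h4 := (h1.trans h2).trans h3
  rw [← Real.exp_add] at h4
  have h5 := Real.log_le_log (Real.exp_pos _) h4
  rw [Real.log_exp] at h5
  simp only [configDiv]
  linarith

end

/-! ### Kullback-Leibler divergence on finite types -/

section PMF
open MeasureTheory InformationTheory
variable {α : Type*} [Fintype α] [MeasurableSpace α] [MeasurableSingletonClass α] {p q : PMF α}

theorem toMeasure_absolutelyContinuous_iff :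
    p.toMeasure ≪ q.toMeasure ↔ ∀ a, q a = 0 → p a = 0 := by
  constructor
  · intro h a ha
    have h1 := @h {a}
    rwa [PMF.toMeasure_apply_singleton _ _ (measurableSet_singleton a),
      PMF.toMeasure_apply_singleton _ _ (measurableSet_singleton a), imp_iff_right ha] at h1
  · intro h s hs
    rw [PMF.toMeasure_apply_fintype, Finset.sum_eq_zero_iff] at hs ⊢
    intro a ha
    have h1 := hs a ha
    by_cases has : a ∈ s
    · rw [Set.indicator_of_mem has] at h1 ⊢
      exact h a h1
    · rw [Set.indicator_of_notMem has]

theorem klDiv_toMeasure_ne_top (h : ∀ a, q a = 0 → p a = 0) :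
    klDiv p.toMeasure q.toMeasure ≠ ∞ :=
  klDiv_ne_top (toMeasure_absolutelyContinuous_iff.2 h) Integrable.of_finite

theorem toReal_klDiv_toMeasure (h : ∀ a, q a = 0 → p a = 0) :
    (klDiv p.toMeasure q.toMeasure).toReal =
      ∑ a, (p a).toReal * Real.log ((p a).toReal / (q a).toReal) := by
  have hac := toMeasure_absolutelyContinuous_iff.2 h
  rw [toReal_klDiv_of_measure_eq hac (by simp), PMF.integral_eq_sum]
  refine Finset.sum_congr rfl fun a _ => ?_
  have h1 := congrArg (fun μ => μ {a}) (Measure.withDensity_rnDeriv_eq _ _ hac)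
  simp only [withDensity_apply _ (measurableSet_singleton a), lintegral_singleton,
    PMF.toMeasure_apply_singleton _ _ (measurableSet_singleton a)] at h1
  have h2 := congrArg ENNReal.toReal h1
  rw [ENNReal.toReal_mul] at h2
  rw [smul_eq_mul, llr]
  by_cases hq : q a = 0
  · simp [h a hq]
  · have hq' : (q a).toReal ≠ 0 := ENNReal.toReal_ne_zero.2 ⟨hq, q.apply_ne_top a⟩
    rw [← h2, mul_div_cancel_right₀ _ hq']

end PMF

/-! ### Divergences of configurations: real values and continuity -/

section
variable {n c m : ℕ} {G : SimpleGraph (Fin n)}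

theorem binWeight_eq_zero_iff {p : unitInterval} {k : Fin (m + 1)} :
    binWeight m p k = 0 ↔ binPMF m p k = 0 := by
  rw [binWeight, ENNReal.toReal_eq_zero_iff, or_iff_left ((binPMF m p).apply_ne_top k)]

theorem binAC_iff {p q : unitInterval} :
    BinAC m p q ↔ ∀ k, binPMF m q k = 0 → binPMF m p k = 0 := by
  simp only [BinAC, binWeight_eq_zero_iff]

theorem BinAC.refl (p : unitInterval) : BinAC m p p := fun _ h => h

theorem binAC_of_mem_Ioo (p : unitInterval) {q : unitInterval} (h0 : 0 < (q : ℝ))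
    (h1 : (q : ℝ) < 1) : BinAC m p q := by
  intro k hk
  rw [binWeight_eq] at hk
  have h2 : (0 : ℝ) < 1 - q := sub_pos.2 h1
  have h3 : 0 < m.choose k := Nat.choose_pos (Nat.lt_succ_iff.1 k.2)
  exact absurd hk (by positivity)

theorem binDiv_self (p : unitInterval) : binDiv m p p = 0 := by
  refine Finset.sum_eq_zero fun k _ => ?_
  by_cases h : binWeight m p k = 0
  · rw [h, zero_mul]
  · rw [div_self h, Real.log_one, mul_zero]

theorem configDiv_eq_zero {M : Config G c} {θ lam : Param n c}
    (h : ∀ i j, M.1 i j = true → lam i j = θ i j) : configDiv m M θ lam = 0 := by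
  refine Finset.sum_eq_zero fun i _ => Finset.sum_eq_zero fun j _ => ?_
  split_ifs with hM
  · rw [h i j hM, binDiv_self]
  · rfl

theorem toReal_KL {M : Config G c} {θ lam : Param n c}
    (h : ∀ i j, M.1 i j = true → BinAC m (θ i j) (lam i j)) :
    KL m M θ lam ≠ ∞ ∧ (KL m M θ lam).toReal = configDiv m M θ lam := by
  have key : ∀ i, InformationTheory.klDiv (linkPMF m M θ i).toMeasure
      (linkPMF m M lam i).toMeasure ≠ ∞ ∧
      (InformationTheory.klDiv (linkPMF m M θ i).toMeasure (linkPMF m M lam i).toMeasure).toReal =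
        ∑ j, if M.1 i j = true then binDiv m (θ i j) (lam i j) else 0 := by
    intro i
    by_cases hi : ∃ j, M.1 i j = true
    · obtain ⟨j, hj⟩ := hi
      have hac := binAC_iff.1 (h i j hj)
      rw [linkPMF_of_active m M θ hj, linkPMF_of_active m M lam hj]
      refine ⟨klDiv_toMeasure_ne_top hac, ?_⟩
      rw [toReal_klDiv_toMeasure hac, Finset.sum_eq_single j _ (by simp), if_pos hj]
      · rfl
      · intro j' _ hne
        exact if_neg fun hj' => hne (M.2.1 i _ _ hj' hj)
    · rw [linkPMF, linkPMF, dif_neg hi, dif_neg hi, InformationTheory.klDiv_self]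
      refine ⟨ENNReal.zero_ne_top, ?_⟩
      rw [ENNReal.toReal_zero]
      exact (Finset.sum_eq_zero fun j _ => if_neg fun hj => hi ⟨j, hj⟩).symm
  refine ⟨ENNReal.sum_ne_top.2 fun i _ => (key i).1, ?_⟩
  rw [KL, ENNReal.toReal_sum fun i _ => (key i).1]
  exact Finset.sum_congr rfl fun i _ => (key i).2

theorem binAC_of_KL_ne_top {M : Config G c} {θ lam : Param n c} (h : KL m M θ lam ≠ ∞)
    {i : Fin n} {j : Fin c} (hj : M.1 i j = true) : BinAC m (θ i j) (lam i j) := by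
  have h1 := ENNReal.sum_ne_top.1 h i (Finset.mem_univ i)
  rw [linkPMF_of_active m M θ hj, linkPMF_of_active m M lam hj] at h1
  exact binAC_iff.2 (toMeasure_absolutelyContinuous_iff.1
    (InformationTheory.klDiv_ne_top_iff.1 h1).1)

theorem continuous_binWeight (k : Fin (m + 1)) : Continuous fun q => binWeight m q k := by
  simp only [binWeight_eq]
  fun_prop

/-- Only points charged by `p` contribute, and there absolute continuity keeps the denominator away
from zero. -/
theorem continuousAt_binDiv {p q : unitInterval} (h : BinAC m p q) :
    ContinuousAt (binDiv m p) q := by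
  unfold binDiv
  refine tendsto_finsetSum _ fun k _ => ?_
  by_cases hp : binWeight m p k = 0
  · simp [hp]
  · have hq : binWeight m q k ≠ 0 := fun hq => hp (h k hq)
    exact ((continuousAt_const.div (continuous_binWeight k).continuousAt hq).log
      (div_ne_zero hp hq)).const_mul _

theorem continuousAt_configDiv {M : Config G c} {θ lam : Param n c}
    (h : ∀ i j, M.1 i j = true → BinAC m (θ i j) (lam i j)) :
    ContinuousAt (configDiv m M θ) lam := by
  unfold configDiv
  refine tendsto_finsetSum _ fun i _ => tendsto_finsetSum _ fun j _ => ?_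
  split_ifs with hM
  · exact (continuousAt_binDiv (h i j hM)).tendsto.comp
      ((continuous_apply_apply i j).tendsto lam)
  · exact tendsto_const_nhds

theorem continuous_mean (M : Config G c) : Continuous (mean M) := by
  unfold mean
  refine continuous_finsetSum _ fun i _ => continuous_finsetSum _ fun j _ => ?_
  split_ifs
  · exact continuous_subtype_val.comp (continuous_apply_apply i j)
  · exact continuous_const

end

/-! ### Perturbation to a parameter with a unique optimum -/

section
variable {n c : ℕ} {G : SimpleGraph (Fin n)}

theorem optMean_eq {θ : Param n c} {Mstar : Config G c} (h : IsUniqueOptimal θ Mstar) :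
    optMean G θ = mean Mstar θ := by
  refine le_antisymm (Finset.sup'_le _ _ fun M _ => ?_) (mean_le_optMean θ Mstar)
  by_cases hM : M = Mstar
  · rw [hM]
  · exact (h M hM).le

theorem mean_congr {M : Config G c} {θ lam : Param n c}
    (h : ∀ i j, M.1 i j = true → lam i j = θ i j) : mean M lam = mean M θ := by
  refine Finset.sum_congr rfl fun i _ => Finset.sum_congr rfl fun j _ => ?_
  split_ifs with hM
  · rw [h i j hM]
  · rfl

theorem mean_lt_mean_of_subset {M N : Config G c} (lam : Param n c)
    (h : ∀ i j, M.1 i j = true → N.1 i j = true) {i : Fin n} {j : Fin c} (hM : ¬ M.1 i j = true)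
    (hN : N.1 i j = true) (hpos : 0 < (lam i j : ℝ)) : mean M lam < mean N lam := by
  have hle : ∀ i j, (if M.1 i j = true then (lam i j : ℝ) else 0) ≤
      if N.1 i j = true then (lam i j : ℝ) else 0 := by
    intro i j
    by_cases h1 : M.1 i j = true
    · rw [if_pos h1, if_pos (h i j h1)]
    · rw [if_neg h1]
      split_ifs
      exacts [(lam i j).2.1, le_rfl]
  refine Finset.sum_lt_sum (fun i _ => Finset.sum_le_sum fun j _ => hle i j)
    ⟨i, Finset.mem_univ i, Finset.sum_lt_sum (fun j _ => hle i j) ⟨j, Finset.mem_univ j, ?_⟩⟩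
  rwa [if_neg hM, if_pos hN]

/-- The entries of a unique optimal configuration have positive means. -/
theorem IsUniqueOptimal.pos {θ : Param n c} {Mstar : Config G c} (h : IsUniqueOptimal θ Mstar)
    {i : Fin n} {j : Fin c} (hij : Mstar.1 i j = true) : 0 < (θ i j : ℝ) := by
  refine (θ i j).2.1.lt_of_ne' fun h0 => ?_
  -- Deleting an entry of mean zero would give a second optimal configuration.
  let N : Config G c := ⟨fun i' j' => Mstar.1 i' j' && !decide (i' = i ∧ j' = j), by
    constructor
    · intro a b b' h1 h2
      rw [Bool.and_eq_true] at h1 h2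
      exact Mstar.2.1 a b b' h1.1 h2.1
    · intro a a' hadj b hb
      rw [Bool.and_eq_true, Bool.and_eq_true] at hb
      exact Mstar.2.2 a a' hadj b ⟨hb.1.1, hb.2.1⟩⟩
  have hne : N ≠ Mstar := by
    intro hN
    have h1 : N.1 i j = true := by rw [hN, hij]
    simp [N] at h1
  refine (h N hne).ne (Finset.sum_congr rfl fun a _ => Finset.sum_congr rfl fun b _ => ?_)
  by_cases hab : a = i ∧ b = j
  · rw [hab.1, hab.2, h0]
    simp
  · simp [N, hab]

/-- Union of two configurations that agree outside a third one. -/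
def union {Mstar M N : Config G c}
    (h : ∀ i j, ¬ Mstar.1 i j = true → M.1 i j = N.1 i j) : Config G c :=
  ⟨fun i j => M.1 i j || N.1 i j, by
    -- Any two entries of the union lie in one feasible configuration: if neither `M` nor `N`
    -- contains both, each entry belongs to exactly one of `M`, `N`, hence to `Mstar`.
    have key : ∀ i j i' j', (M.1 i j || N.1 i j) = true → (M.1 i' j' || N.1 i' j') = true →
        ∃ Q : Config G c, Q.1 i j = true ∧ Q.1 i' j' = true := by
      intro i j i' j' h1 h2
      have h3 := h i j
      have h4 := h i' j'
      by_cases hM : M.1 i j = true ∧ M.1 i' j' = true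
      · exact ⟨M, hM⟩
      by_cases hN : N.1 i j = true ∧ N.1 i' j' = true
      · exact ⟨N, hN⟩
      refine ⟨Mstar, ?_⟩
      grind
    constructor
    · intro i j j' h1 h2
      obtain ⟨Q, hQ1, hQ2⟩ := key i j i j' h1 h2
      exact Q.2.1 i j j' hQ1 hQ2
    · intro i i' hadj j hj
      obtain ⟨Q, hQ1, hQ2⟩ := key i j i' j hj.1 hj.2
      exact Q.2.2 i i' hadj j ⟨hQ1, hQ2⟩⟩

/-- If two such optima differed, their union would strictly contain one of them, the extra entry
lying in `Mstar` and having positive mean. -/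
theorem eq_of_forall_mean_le {lam : Param n c} {Mstar M N : Config G c}
    (hpos : ∀ i j, Mstar.1 i j = true → 0 < (lam i j : ℝ))
    (hMN : ∀ i j, ¬ Mstar.1 i j = true → M.1 i j = N.1 i j)
    (hM : ∀ Q : Config G c, mean Q lam ≤ mean M lam)
    (hN : ∀ Q : Config G c, mean Q lam ≤ mean N lam) : M = N := by
  refine Subtype.ext (funext fun i => funext fun j => ?_)
  by_contra hne
  have hij : Mstar.1 i j = true := by
    by_contra h
    exact hne (hMN i j h)
  by_cases h : M.1 i j = true
  · have h' : ¬ N.1 i j = true := fun h' => hne (h.trans h'.symm)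
    exact (hN (union hMN)).not_gt (mean_lt_mean_of_subset lam (fun a b hab => by simp [union, hab])
      h' (by simp [union, h]) (hpos i j hij))
  · have h' : N.1 i j = true := by
      by_contra h'
      exact hne ((Bool.eq_false_iff.2 h).trans (Bool.eq_false_iff.2 h').symm)
    exact (hM (union hMN)).not_gt (mean_lt_mean_of_subset lam (fun a b hab => by simp [union, hab])
      h (by simp [union, h']) (hpos i j hij))

theorem exists_isUniqueOptimal {lam : Param n c} {Mstar : Config G c}
    (hpos : ∀ i j, Mstar.1 i j = true → 0 < (lam i j : ℝ))
    (hsep : ∀ M N : Config G c, mean M lam = mean N lam →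
      ∀ i j, ¬ Mstar.1 i j = true → M.1 i j = N.1 i j) :
    ∃ M : Config G c, IsUniqueOptimal lam M := by
  obtain ⟨M, hM⟩ := Finite.exists_max fun M : Config G c => mean M lam
  refine ⟨M, fun N hN => (hM N).lt_of_ne fun h => hN ?_⟩
  exact eq_of_forall_mean_le hpos (hsep N M h) (fun Q => (hM Q).trans_eq h.symm) hM

/-- Perturbation of `lam` outside `Mstar`, of a different order on every entry. -/
noncomputable def perturbPoly (Mstar : Config G c) (lam : Param n c) (i : Fin n) (j : Fin c) :
    Polynomial ℝ :=
  Polynomial.C (lam i j : ℝ) + if Mstar.1 i j = true then 0 else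
    Polynomial.C (if (lam i j : ℝ) < 1 / 2 then 1 else -1) * Polynomial.X ^ ((finProdFinEquiv (i, j) : ℕ) + 1)

/-- The parameter with entries `perturbPoly` evaluated at `t`. -/
noncomputable def perturb (Mstar : Config G c) (lam : Param n c) (t : ℝ) : Param n c :=
  fun i j => Set.projIcc 0 1 zero_le_one ((perturbPoly Mstar lam i j).eval t)

theorem perturb_of_mem {Mstar : Config G c} (lam : Param n c) (t : ℝ) {i : Fin n} {j : Fin c}
    (h : Mstar.1 i j = true) : perturb Mstar lam t i j = lam i j := by
  simp [perturb, perturbPoly, h]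

theorem continuous_perturb (Mstar : Config G c) (lam : Param n c) :
    Continuous (perturb Mstar lam) :=
  continuous_pi fun i => continuous_pi fun j =>
    continuous_projIcc.comp (perturbPoly Mstar lam i j).continuous

theorem perturb_zero (Mstar : Config G c) (lam : Param n c) : perturb Mstar lam 0 = lam := by
  funext i j
  unfold perturb perturbPoly
  split_ifs <;> simp

/-- Entries below `1/2` move up and the others move down, by at most `t < 1/2`. -/
theorem perturbPoly_eval_mem_Ioo {Mstar : Config G c} (lam : Param n c) {t : ℝ} (h0 : 0 < t)
    (h1 : t < 1 / 2) {i : Fin n} {j : Fin c} (h : ¬ Mstar.1 i j = true) :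
    (perturbPoly Mstar lam i j).eval t ∈ Set.Ioo (0 : ℝ) 1 := by
  have hl0 := (lam i j).2.1
  have hl1 := (lam i j).2.2
  have hp : 0 < t ^ ((finProdFinEquiv (i, j) : ℕ) + 1) := by positivity
  have hp1 : t ^ ((finProdFinEquiv (i, j) : ℕ) + 1) ≤ t :=
    pow_le_of_le_one h0.le (by linarith) (Nat.succ_ne_zero _)
  rw [perturbPoly, if_neg h]
  split_ifs with hl
  · simp only [map_one, one_mul, Polynomial.eval_add, Polynomial.eval_C, Polynomial.eval_pow,
      Polynomial.eval_X]
    constructor <;> linarith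
  · simp only [map_neg, map_one, neg_mul, one_mul, Polynomial.eval_add, Polynomial.eval_C,
      Polynomial.eval_neg, Polynomial.eval_pow, Polynomial.eval_X]
    constructor <;> linarith

theorem perturb_eq_eval (Mstar : Config G c) (lam : Param n c) {t : ℝ} (h0 : 0 < t)
    (h1 : t < 1 / 2) (i : Fin n) (j : Fin c) :
    (perturb Mstar lam t i j : ℝ) = (perturbPoly Mstar lam i j).eval t := by
  by_cases h : Mstar.1 i j = true
  · rw [perturb_of_mem lam t h, perturbPoly, if_pos h]
    simp
  · have := perturbPoly_eval_mem_Ioo lam h0 h1 h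
    rw [perturb, Set.projIcc_of_mem zero_le_one (Set.Ioo_subset_Icc_self this)]

/-- The mean of `M` under the perturbed parameter. -/
noncomputable def meanPoly (Mstar : Config G c) (lam : Param n c) (M : Config G c) :
    Polynomial ℝ :=
  ∑ i, ∑ j, if M.1 i j = true then perturbPoly Mstar lam i j else 0

theorem mean_perturb (Mstar : Config G c) (lam : Param n c) (M : Config G c) {t : ℝ} (h0 : 0 < t)
    (h1 : t < 1 / 2) : mean M (perturb Mstar lam t) = (meanPoly Mstar lam M).eval t := by
  simp only [mean, meanPoly, Polynomial.eval_finsetSum, perturb_eq_eval Mstar lam h0 h1]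
  refine Finset.sum_congr rfl fun i _ => Finset.sum_congr rfl fun j _ => ?_
  split_ifs <;> simp

theorem perturbPoly_coeff (Mstar : Config G c) (lam : Param n c) {i : Fin n} {j : Fin c}
    (h : ¬ Mstar.1 i j = true) (i' : Fin n) (j' : Fin c) :
    (perturbPoly Mstar lam i' j').coeff ((finProdFinEquiv (i, j) : ℕ) + 1) =
      if i' = i ∧ j' = j then (if (lam i j : ℝ) < 1 / 2 then 1 else -1) else 0 := by
  rw [perturbPoly, Polynomial.coeff_add, Polynomial.coeff_C_succ, zero_add]
  by_cases hij : i' = i ∧ j' = j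
  · obtain ⟨rfl, rfl⟩ := hij
    rw [if_neg h, Polynomial.coeff_C_mul, Polynomial.coeff_X_pow_self, mul_one]
    simp
  · rw [if_neg hij]
    split_ifs
    · simp
    all_goals
      rw [Polynomial.coeff_C_mul, Polynomial.coeff_X_pow, if_neg, mul_zero]
      intro heq
      have h2 := finProdFinEquiv.injective (Fin.ext (Nat.succ_injective heq))
      exact hij ⟨(congrArg Prod.fst h2).symm, (congrArg Prod.snd h2).symm⟩

theorem meanPoly_coeff (Mstar : Config G c) (lam : Param n c) (M : Config G c) {i : Fin n}
    {j : Fin c} (h : ¬ Mstar.1 i j = true) :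
    (meanPoly Mstar lam M).coeff ((finProdFinEquiv (i, j) : ℕ) + 1) =
      if M.1 i j = true then (if (lam i j : ℝ) < 1 / 2 then 1 else -1) else 0 := by
  simp only [meanPoly, Polynomial.finsetSum_coeff, apply_ite (fun p : Polynomial ℝ =>
    p.coeff ((finProdFinEquiv (i, j) : ℕ) + 1)), perturbPoly_coeff Mstar lam h,
    Polynomial.coeff_zero]
  rw [Finset.sum_eq_single i _ (by simp), Finset.sum_eq_single j _ (by simp)]
  · simp
  · intro j' _ hj'
    simp [hj']
  · intro i' _ hi'
    simp [hi']

/-- Each entry outside `Mstar` owns a power of `X`, whose coefficient in `meanPoly` is `±1` or `0`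
according to membership. -/
theorem eq_of_meanPoly_eq {Mstar : Config G c} {lam : Param n c} {M N : Config G c}
    (h : meanPoly Mstar lam M = meanPoly Mstar lam N) {i : Fin n} {j : Fin c}
    (hij : ¬ Mstar.1 i j = true) : M.1 i j = N.1 i j := by
  have h1 := congrArg (fun p => p.coeff ((finProdFinEquiv (i, j) : ℕ) + 1)) h
  simp only [meanPoly_coeff Mstar lam _ hij] at h1
  split_ifs at h1 <;> simp_all

theorem eventually_eval_ne_zero {p : Polynomial ℝ} (hp : p ≠ 0) :
    ∀ᶠ t in 𝓝[>] (0 : ℝ), p.eval t ≠ 0 := by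
  have h1 : ((p.roots.toFinset.erase 0 : Finset ℝ) : Set ℝ)ᶜ ∈ 𝓝 (0 : ℝ) :=
    (Finset.finite_toSet _).isClosed.isOpen_compl.mem_nhds (by simp)
  filter_upwards [nhdsWithin_le_nhds h1, self_mem_nhdsWithin] with t ht ht0 h0
  exact ht (by simp [hp, (Set.mem_Ioi.1 ht0).ne', h0])

theorem eventually_perturb_isUniqueOptimal {θ lam : Param n c} {Mstar M : Config G c}
    (hstar : IsUniqueOptimal θ Mstar) (hlam : lam ∈ badSet θ Mstar M) :
    ∀ᶠ t in 𝓝[>] (0 : ℝ), (∀ i j, Mstar.1 i j = true → perturb Mstar lam t i j = θ i j) ∧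
      (∀ i j, ¬ Mstar.1 i j = true → 0 < (perturb Mstar lam t i j : ℝ) ∧
        (perturb Mstar lam t i j : ℝ) < 1) ∧
      ∃ M', M' ≠ Mstar ∧ IsUniqueOptimal (perturb Mstar lam t) M' := by
  -- There are finitely many pairs, and each nonzero difference polynomial has no root in some
  -- interval `(0, ε)`.
  have hsep : ∀ᶠ t in 𝓝[>] (0 : ℝ), ∀ M N : Config G c,
      meanPoly Mstar lam M ≠ meanPoly Mstar lam N →
        (meanPoly Mstar lam M - meanPoly Mstar lam N).eval t ≠ 0 := by
    refine eventually_all.2 fun M => eventually_all.2 fun N => ?_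
    by_cases h : meanPoly Mstar lam M = meanPoly Mstar lam N
    · exact Eventually.of_forall fun t h' => absurd h h'
    · exact (eventually_eval_ne_zero (sub_ne_zero.2 h)).mono fun t ht _ => ht
  have hgt : ∀ᶠ t in 𝓝[>] (0 : ℝ), optMean G θ < mean M (perturb Mstar lam t) := by
    have h1 := ((continuous_mean M).comp (continuous_perturb Mstar lam)).tendsto 0
    simp only [Function.comp_apply, perturb_zero] at h1
    exact (h1.mono_left nhdsWithin_le_nhds).eventually (lt_mem_nhds hlam.2)
  filter_upwards [hsep, hgt, Ioo_mem_nhdsGT (show (0 : ℝ) < 1 / 2 by norm_num)]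
    with t hsep hgt ⟨h0, h1⟩
  have hagree : ∀ i j, Mstar.1 i j = true → perturb Mstar lam t i j = θ i j := fun i j hij => by
    rw [perturb_of_mem lam t hij, hlam.1 i j hij]
  refine ⟨hagree, fun i j hij => ?_, ?_⟩
  · rw [perturb_eq_eval Mstar lam h0 h1]
    exact perturbPoly_eval_mem_Ioo lam h0 h1 hij
  · obtain ⟨M', hM'⟩ := exists_isUniqueOptimal (lam := perturb Mstar lam t) (Mstar := Mstar)
      (fun i j hij => by rw [hagree i j hij]; exact hstar.pos hij) (fun M N hMN i j hij => by
        refine eq_of_meanPoly_eq (lam := lam) ?_ hij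
        by_contra hne
        refine hsep M N hne ?_
        rw [Polynomial.eval_sub, ← mean_perturb Mstar lam M h0 h1,
          ← mean_perturb Mstar lam N h0 h1, hMN, sub_self])
    -- `Mstar` still has mean `μ^⋆`, which `M` exceeds.
    refine ⟨M', fun h => ?_, hM'⟩
    rw [h] at hM'
    have h2 := mean_le_optMean (G := G) (perturb Mstar lam t) M
    rw [optMean_eq hM', mean_congr hagree, ← optMean_eq hstar] at h2
    exact hgt.not_ge h2

end

/-! ### Asymptotic rates and feasibility of their limits -/

section
variable {n c m : ℕ} {G : SimpleGraph (Fin n)}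

theorem tendsto_log_natCast : Tendsto (fun T : ℕ => Real.log T) atTop atTop :=
  Real.tendsto_log_atTop.comp tendsto_natCast_atTop_atTop

/-- The optimal configuration is selected in almost all slots. -/
theorem tendsto_expectedCount_div {π : Policy G c m} (hπ : UniformlyGood π) {θ : Param n c}
    {Mstar : Config G c} (hstar : IsUniqueOptimal θ Mstar) :
    Tendsto (fun T : ℕ => expectedCount π θ Mstar T / T) atTop (𝓝 1) := by
  have h1 : Tendsto (fun T : ℕ => 1 - ∑ Q ∈ Finset.univ.erase Mstar, expectedCount π θ Q T / T)
      atTop (𝓝 (1 - ∑ Q ∈ Finset.univ.erase Mstar, (0 : ℝ))) := by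
    refine tendsto_const_nhds.sub (tendsto_finsetSum _ fun Q hQ => ?_)
    have h := (hπ θ Mstar hstar Q (Finset.ne_of_mem_erase hQ) 1 one_pos).tendsto_div_nhds_zero
    simpa only [Real.rpow_one] using h
  rw [Finset.sum_const_zero, sub_zero] at h1
  refine h1.congr' ?_
  filter_upwards [eventually_gt_atTop 0] with T hT
  have hT' : (T : ℝ) ≠ 0 := by positivity
  have h2 := sum_expectedCount π θ T
  rw [← Finset.add_sum_erase _ _ (Finset.mem_univ Mstar)] at h2
  rw [← Finset.sum_div, sub_eq_iff_eq_add, ← add_div, h2, div_self hT']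

/-- Asymptotic information inequality: the exploration needed to reject `lam`. -/
theorem one_le_sum_mul_configDiv {π : Policy G c m} (hπ : UniformlyGood π) {θ lam : Param n c}
    {Mstar M : Config G c} (hstar : IsUniqueOptimal θ Mstar) (hne : M ≠ Mstar)
    (hM : IsUniqueOptimal lam M) (hagree : ∀ i j, Mstar.1 i j = true → lam i j = θ i j)
    (hac : ∀ i j, BinAC m (θ i j) (lam i j)) {F : Filter ℕ} [F.NeBot] (hF : F ≤ atTop)
    {x : Config G c → ℝ} (hx : ∀ Q, Q ≠ Mstar →
      Tendsto (fun T : ℕ => expectedCount π θ Q T / Real.log T) F (𝓝 (x Q))) :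
    1 ≤ ∑ Q ∈ Finset.univ.erase Mstar, x Q * configDiv m Q θ lam := by
  have key : ∀ γ : ℝ, 0 < γ → γ < 1 →
      1 - γ ≤ ∑ Q ∈ Finset.univ.erase Mstar, x Q * configDiv m Q θ lam := by
    intro γ hγ hγ1
    have hleft : Tendsto (fun T : ℕ => (1 - γ) * (expectedCount π θ Mstar T / T)) F
        (𝓝 ((1 - γ) * 1)) :=
      ((tendsto_expectedCount_div hπ hstar).mono_left hF).const_mul _
    have hright : Tendsto (fun T : ℕ => ∑ Q ∈ Finset.univ.erase Mstar,
        expectedCount π θ Q T / Real.log T * configDiv m Q θ lam + Real.log 2 / Real.log T) F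
        (𝓝 (∑ Q ∈ Finset.univ.erase Mstar, x Q * configDiv m Q θ lam + 0)) :=
      (tendsto_finsetSum _ fun Q hQ => (hx Q (Finset.ne_of_mem_erase hQ)).mul_const _).add
        ((tendsto_const_nhds.div_atTop tendsto_log_natCast).mono_left hF)
    rw [mul_one] at hleft
    rw [add_zero] at hright
    refine le_of_tendsto_of_tendsto hleft hright (hF ?_)
    filter_upwards [eventually_gt_atTop 1,
      (hπ lam M hM Mstar hne.symm γ hγ).bound one_pos] with T hT hbound
    have hT0 : (0 : ℝ) < T := by positivity
    have hlog : 0 < Real.log T := Real.log_pos (Nat.one_lt_cast.2 hT)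
    rw [Real.norm_of_nonneg (expectedCount_nonneg π lam Mstar T),
      Real.norm_of_nonneg (by positivity), one_mul] at hbound
    have hE := expectedCount_nonneg π lam Mstar T
    -- With this exponent `exp a = T ^ (1 - γ)`, which exactly offsets the bound `T ^ γ / T` on the
    -- fraction of `Mstar` under `lam`; the logarithm stays below `log 2`.
    have h1 := mul_expectedCount_le π hac (zero_lt_one.trans hT) Mstar
      (Real.log T * (1 - γ))
    rw [← Real.rpow_def_of_pos hT0] at h1
    have h2 : expectedCount π lam Mstar T / T * ((T : ℝ) ^ (1 - γ) - 1) ≤ 1 := by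
      calc expectedCount π lam Mstar T / T * ((T : ℝ) ^ (1 - γ) - 1)
          ≤ expectedCount π lam Mstar T / T * (T : ℝ) ^ (1 - γ) :=
            mul_le_mul_of_nonneg_left (by linarith) (by positivity)
        _ ≤ (T : ℝ) ^ γ / T * (T : ℝ) ^ (1 - γ) := by gcongr
        _ = 1 := by
            rw [div_mul_eq_mul_div, ← Real.rpow_add hT0, add_sub_cancel, Real.rpow_one,
              div_self hT0.ne']
    have h3 : 0 ≤ expectedCount π lam Mstar T / T * ((T : ℝ) ^ (1 - γ) - 1) :=
      mul_nonneg (by positivity)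
        (sub_nonneg.2 (Real.one_le_rpow (Nat.one_le_cast.2 hT.le) (by linarith)))
    have h4 : Real.log (1 + expectedCount π lam Mstar T / T * ((T : ℝ) ^ (1 - γ) - 1)) ≤
        Real.log 2 := Real.log_le_log (by linarith) (by linarith)
    -- The `Mstar` term, of order `T`, drops out because `lam` and `θ` agree there.
    rw [← Finset.add_sum_erase _ _ (Finset.mem_univ Mstar), configDiv_eq_zero hagree, mul_zero,
      zero_add] at h1
    have h5 := h1.trans (add_le_add_right h4 _)
    rw [mul_assoc, mul_comm, ← le_div_iff₀ hlog, add_div, Finset.sum_div] at h5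
    simpa only [div_mul_eq_mul_div] using h5
  refine le_of_forall_pos_sub_le fun ε hε => ?_
  exact (sub_le_sub_left (min_le_left ε (1 / 2)) 1).trans
    (key _ (lt_min hε (by norm_num)) (by
      exact (min_le_right ε (1 / 2)).trans_lt (by norm_num)))

/-- Limits of the exploration rates satisfy the constraints of the optimisation problem. -/
theorem mem_feasibleRates_of_tendsto {π : Policy G c m} (hπ : UniformlyGood π) {θ : Param n c}
    {Mstar : Config G c} (hstar : IsUniqueOptimal θ Mstar) {F : Filter ℕ} [F.NeBot]
    (hF : F ≤ atTop) {x : Config G c → ℝ≥0} (hx : ∀ Q, Q ≠ Mstar →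
      Tendsto (fun T : ℕ => expectedCount π θ Q T / Real.log T) F (𝓝 (x Q : ℝ))) :
    x ∈ feasibleRates m θ Mstar := by
  intro M _
  refine le_iInf₂ fun lam hlam => ?_
  -- An infinite term makes the constraint trivial. Otherwise every `Q` with `x Q ≠ 0` has finite
  -- divergence, hence absolute continuity; where `x Q = 0` the value of `configDiv` is irrelevant.
  by_cases htop : ∃ Q ∈ Finset.univ.erase Mstar, (x Q : ℝ≥0∞) * KL m Q θ lam = ∞
  · rw [ENNReal.sum_eq_top.2 htop]
    exact le_top
  push Not at htop
  have hac : ∀ Q ∈ Finset.univ.erase Mstar, x Q ≠ 0 →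
      ∀ i j, Q.1 i j = true → BinAC m (θ i j) (lam i j) := by
    intro Q hQ hxQ i j hij
    refine binAC_of_KL_ne_top (fun h => htop Q hQ ?_) hij
    rw [h, ENNReal.mul_top (ENNReal.coe_ne_zero.2 hxQ)]
  have hterm : ∀ Q ∈ Finset.univ.erase Mstar,
      ((x Q : ℝ≥0∞) * KL m Q θ lam).toReal = (x Q : ℝ) * configDiv m Q θ lam := by
    intro Q hQ
    rw [ENNReal.toReal_mul, ENNReal.coe_toReal]
    by_cases hxQ : x Q = 0
    · simp [hxQ]
    · rw [(toReal_KL (hac Q hQ hxQ)).2]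
  have hlim : Tendsto (fun t => ∑ Q ∈ Finset.univ.erase Mstar,
      (x Q : ℝ) * configDiv m Q θ (perturb Mstar lam t)) (𝓝[>] 0)
      (𝓝 (∑ Q ∈ Finset.univ.erase Mstar, (x Q : ℝ) * configDiv m Q θ lam)) := by
    refine tendsto_finsetSum _ fun Q hQ => ?_
    by_cases hxQ : x Q = 0
    · simp [hxQ]
    · have h1 := (continuous_perturb Mstar lam).tendsto 0
      rw [perturb_zero] at h1
      exact ((continuousAt_configDiv (hac Q hQ hxQ)).tendsto.comp
        (h1.mono_left nhdsWithin_le_nhds)).const_mul _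
  have hone : 1 ≤ ∑ Q ∈ Finset.univ.erase Mstar, (x Q : ℝ) * configDiv m Q θ lam := by
    refine ge_of_tendsto hlim ?_
    filter_upwards [eventually_perturb_isUniqueOptimal hstar hlam] with t ⟨h1, h2, M', hne, h3⟩
    refine one_le_sum_mul_configDiv hπ hstar hne h3 h1 (fun i j => ?_) hF hx
    by_cases hij : Mstar.1 i j = true
    · rw [h1 i j hij]
      exact BinAC.refl _
    · exact binAC_of_mem_Ioo _ (h2 i j hij).1 (h2 i j hij).2
  rw [← Finset.sum_congr rfl hterm, ← ENNReal.toReal_sum htop, ← ENNReal.toReal_one] at hone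
  exact (ENNReal.toReal_le_toReal ENNReal.one_ne_top (ENNReal.sum_ne_top.2 htop)).1 hone

end
end SpectrumBandit

/-! ### The regret lower bound -/

theorem theorem1 {n c : ℕ} (G : SimpleGraph (Fin n)) (m : ℕ) (hm : 0 < m)
    (θ : SpectrumBandit.Param n c) (Mstar : SpectrumBandit.Config G c)
    (hstar : SpectrumBandit.IsUniqueOptimal θ Mstar)
    (π : SpectrumBandit.Policy G c m) (hπ : SpectrumBandit.UniformlyGood π) :
    SpectrumBandit.C m θ Mstar ≤
      Filter.liminf
        (fun T : ℕ => ((SpectrumBandit.regret π θ T / Real.log (T : ℝ) : ℝ) : EReal))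
        Filter.atTop := by
  open SpectrumBandit in
  by_contra! hlt
  obtain ⟨b, hb1, hb2⟩ := EReal.lt_iff_exists_real_btwn.1 hlt
  have hfreq := frequently_lt_of_liminf_lt (by isBoundedDefault) hb1
  simp only [EReal.coe_lt_coe_iff] at hfreq
  have hne : (atTop ⊓ 𝓟 {T : ℕ | regret π θ T / Real.log T < b}).NeBot :=
    frequently_mem_iff_neBot.1 hfreq
  -- An ultrafilter makes all the bounded rates converge at once, in place of successive
  -- subsequences.
  let U := Ultrafilter.of (atTop ⊓ 𝓟 {T : ℕ | regret π θ T / Real.log T < b})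
  have hU := Ultrafilter.of_le (atTop ⊓ 𝓟 {T : ℕ | regret π θ T / Real.log T < b})
  have hUtop : (U : Filter ℕ) ≤ atTop := hU.trans inf_le_left
  have hUb : ∀ᶠ T : ℕ in U, regret π θ T / Real.log T < b :=
    hU (mem_inf_of_right (mem_principal_self _))
  have hregret : ∀ T : ℕ, regret π θ T / Real.log T =
      ∑ M, expectedCount π θ M T / Real.log T * (optMean G θ - mean M θ) := fun T => by
    rw [regret_eq π θ hm, Finset.sum_div]
    exact Finset.sum_congr rfl fun M _ => by ring
  have hlim : ∀ Q, Q ≠ Mstar → ∃ x : ℝ≥0,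
      Tendsto (fun T : ℕ => expectedCount π θ Q T / Real.log T) U (𝓝 (x : ℝ)) := by
    intro Q hQ
    have hgap : 0 < optMean G θ - mean Q θ := by
      rw [optMean_eq hstar]
      exact sub_pos.2 (hstar Q hQ)
    -- All summands of the regret are nonnegative for `T > 1`, so each one alone is at most `b`.
    have hmem : ∀ᶠ T : ℕ in U, expectedCount π θ Q T / Real.log T ∈
        Set.Icc 0 (b / (optMean G θ - mean Q θ)) := by
      filter_upwards [hUb, hUtop (eventually_gt_atTop 1)] with T hT hT1
      have hlog : 0 < Real.log T := Real.log_pos (Nat.one_lt_cast.2 hT1)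
      have hnonneg : ∀ M, 0 ≤ expectedCount π θ M T / Real.log T :=
        fun M => div_nonneg (expectedCount_nonneg π θ M T) hlog.le
      refine ⟨hnonneg Q, (le_div_iff₀ hgap).2 ?_⟩
      refine le_trans ?_ hT.le
      rw [hregret]
      exact Finset.single_le_sum (f := fun M =>
        expectedCount π θ M T / Real.log T * (optMean G θ - mean M θ))
        (fun M _ => mul_nonneg (hnonneg M) (sub_nonneg.2 (mean_le_optMean θ M)))
        (Finset.mem_univ Q)
    obtain ⟨x, hx, hle⟩ := isCompact_Icc.ultrafilter_le_nhds'
      (U.map fun T : ℕ => expectedCount π θ Q T / Real.log T) hmem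
    exact ⟨⟨x, hx.1⟩, hle⟩
  -- The value `x Mstar` is arbitrary: the constraints omit it and its gap in the objective is zero.
  choose! x hx using hlim
  have hC : C m θ Mstar ≤ ((∑ M : Config G c, (x M : ℝ) * (optMean G θ - mean M θ) : ℝ) : EReal) :=
    iInf₂_le x (mem_feasibleRates_of_tendsto hπ hstar hUtop hx)
  have hle : ∑ M : Config G c, (x M : ℝ) * (optMean G θ - mean M θ) ≤ b := by
    refine le_of_tendsto (f := fun T : ℕ => regret π θ T / Real.log T) (x := (U : Filter ℕ)) ?_
      (hUb.mono fun T hT => hT.le)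
    simp only [hregret]
    refine tendsto_finsetSum _ fun M _ => ?_
    by_cases hM : M = Mstar
    · rw [hM, optMean_eq hstar, sub_self]
      simp
    · exact (hx M hM).mul_const _
  exact (hb2.trans_le hC).not_ge (EReal.coe_le_coe_iff.2 hle)
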